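/- Let $n\ge 2$ be an integer. Let $\Gamma(\mathbb{Z}_n)$ be the zero divisor graph of the ring $\mathbb{Z}_n$ of integers modulo $n$: its vertices are the nonzero $x\in\mathbb{Z}_n$ for which there is a nonzero $y\in\mathbb{Z}_n$ with $xy=0$, and two distinct vertices $x,y$ are adjacent if and only if $xy=0$. Let $\Upsilon_n$ be the simple graph whose vertices are the divisors $d$ of $n$ with $1<d<n$, two distinct vertices $d,e$ being adjacent (written $d\sim e$) if and only if $n\mid de$. Let $\mathbf{L}(\Upsilon_n)$ be the matrix, indexed by the vertices of $\Upsilon_n$, with diagonal entries $\mathbf{L}(\Upsilon_n)_{d,d}=\sum_{e\sim d}\phi(n/e)$ and, for $d\neq e$, entries $\mathbf{L}(\Upsilon_n)_{d,e}=-\phi(n/e)$ if $d\sim e$ and $0$ otherwise, where $\phi$ is Euler's totient function. The algebraic connectivity and the Laplacian spectral radius of a finite simple graph are the second smallest and the largest eigenvalue, respectively, of its Laplacian matrix (the diagonal matrix of vertex degrees minus the adjacency matrix); eigenvalues are counted with multiplicity. If $n$ is not a power of a prime, then all eigenvalues of $\mathbf{L}(\Upsilon_n)$ are real, and the following hold.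 (i) If $n$ is neither a prime power nor a product of two distinct primes, then the algebraic connectivity of $\Gamma(\mathbb{Z}_n)$ equals the second smallest eigenvalue of $\mathbf{L}(\Upsilon_n)$. (ii) If $n$ is not a prime power, then the Laplacian spectral radius of $\Gamma(\mathbb{Z}_n)$ equals the largest eigenvalue of $\mathbf{L}(\Upsilon_n)$. -/

import Mathlib

/-- A zero divisor of `R`: a nonzero `x` that is annihilated by some nonzero `y`. -/
abbrev ZeroDivisor (R : Type*) [CommRing R] : Type _ :=
  {x : R // x ≠ 0 ∧ ∃ y : R, y ≠ 0 ∧ x * y = 0}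

/-- The zero divisor graph `Γ(R)`: the vertices are the zero divisors of `R`, and two distinct
vertices are adjacent if and only if their product is zero. -/
def zeroDivisorGraph (R : Type*) [CommRing R] : SimpleGraph (ZeroDivisor R) where
  Adj x y := x ≠ y ∧ (x : R) * (y : R) = 0
  symm := ⟨fun x y h => ⟨h.1.symm, by rw [mul_comm]; exact h.2⟩⟩
  loopless := ⟨fun _ h => h.1 rfl⟩

instance (R : Type*) [CommRing R] [DecidableEq R] :
    DecidableRel (zeroDivisorGraph R).Adj :=
  fun x y => inferInstanceAs (Decidable (x ≠ y ∧ (x : R) * (y : R) = 0))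

/-- A divisor `d` of `n` with `1 < d < n`. -/
abbrev ProperDivisor (n : ℕ) : Type :=
  {d : ℕ // d ∈ (Finset.Ioo 1 n).filter (fun d => d ∣ n)}

/-- The graph `Υ_n` on the proper divisors of `n`: two distinct vertices `d`, `e` are adjacent
if and only if `n` divides `d * e`. -/
def divisorGraph (n : ℕ) : SimpleGraph (ProperDivisor n) where
  Adj d e := d ≠ e ∧ n ∣ (d : ℕ) * (e : ℕ)
  symm := ⟨fun d e h => ⟨h.1.symm, by rw [mul_comm]; exact h.2⟩⟩
  loopless := ⟨fun _ h => h.1 rfl⟩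

instance (n : ℕ) : DecidableRel (divisorGraph n).Adj :=
  fun d e => inferInstanceAs (Decidable (d ≠ e ∧ n ∣ (d : ℕ) * (e : ℕ)))

/-- The vertex weighted Laplacian matrix of a graph `G` with vertex weights `m`. -/
def weightedLaplacian {V : Type*} [Fintype V] [DecidableEq V] (G : SimpleGraph V)
    [DecidableRel G.Adj] (m : V → ℝ) : Matrix V V ℝ :=
  Matrix.of fun i j =>
    if i = j then ∑ r ∈ G.neighborFinset i, m r
    else if G.Adj i j then -m j
    else 0

/-- The matrix `𝐋(Υ_n)`: the vertex `d` of `Υ_n` has weight `φ(n / d)`. -/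
def divisorLaplacian (n : ℕ) : Matrix (ProperDivisor n) (ProperDivisor n) ℝ :=
  weightedLaplacian (divisorGraph n) fun d => ((n / (d : ℕ)).totient : ℝ)

/-- All the (complex) eigenvalues of `A` are real, and `x` is the second smallest of them, counted
with multiplicity. -/
def IsSecondSmallestEigenvalue {V : Type*} [Fintype V] [DecidableEq V] (A : Matrix V V ℝ)
    (x : ℝ) : Prop :=
  A.charpoly.Splits ∧ (A.charpoly.roots.sort (· ≤ ·))[1]? = some x

/-- All the (complex) eigenvalues of `A` are real, and `x` is the largest of them. -/
def IsLargestEigenvalue {V : Type*} [Fintype V] [DecidableEq V] (A : Matrix V V ℝ)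
    (x : ℝ) : Prop :=
  A.charpoly.Splits ∧ IsGreatest {y | y ∈ A.charpoly.roots} x

/-- `x` is the algebraic connectivity of `G`. -/
def IsAlgebraicConnectivity {V : Type*} [Fintype V] [DecidableEq V] (G : SimpleGraph V)
    [DecidableRel G.Adj] (x : ℝ) : Prop :=
  IsSecondSmallestEigenvalue (G.lapMatrix ℝ) x

/-- `x` is the Laplacian spectral radius of `G`. -/
def IsLaplacianSpectralRadius {V : Type*} [Fintype V] [DecidableEq V] (G : SimpleGraph V)
    [DecidableRel G.Adj] (x : ℝ) : Prop :=
  IsLargestEigenvalue (G.lapMatrix ℝ) x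

/-! Grouping the zero divisors `x` of `ZMod n` by `gcd (n, x)` exhibits `Γ(ℤ_n)` as a generalized
join over `Υ_n` whose class at `d` has `φ(n / d)` elements. Let `k d` be the total size of the
classes `e` with `n ∣ d * e`. The Laplacian of `Γ(ℤ_n)` is `diag (k (gcd (n, x))) - P B`, where `P`
is the incidence matrix of vertices and classes, and `𝐋(Υ_n)` is `diag (k d) - B P`. By a
Sylvester-type determinant identity the first spectrum is therefore the second one together with
copies of the numbers `k d`. It remains to see that these disturb neither end of the spectrum.

* They do not exceed the largest eigenvalue `ρ`: the spectrum of `𝐋 = 𝐋(Υ_n)` lies in `[0, ρ]`, so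
  `(𝐋²)_dd ≤ ρ 𝐋_dd`, and this bounds by `ρ` the size of the class of `d` plus those of its
  neighbours.
* They are at least the second smallest eigenvalue: the least prime factor `p` of `n` has the single
  neighbour `n / p`, and Courant–Fischer with a two-dimensional space of functions vanishing at
  `n / p` bounds that eigenvalue by `φ(p)`, which is at most every `k d`.
-/

open Finset Matrix Polynomial

section Charpoly

variable {V W R : Type*} [Fintype V] [DecidableEq V] [Fintype W] [DecidableEq W] [CommRing R]

theorem det_add_mul_mul_det_of_intertwine {A : Matrix W W R} {D : Matrix V V R}
    {P : Matrix W V R} (B : Matrix V W R) (h : A * P = P * D) :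
    (A + P * B).det * D.det = A.det * (D + B * P).det := by
  have hblock : fromBlocks A (-P) B 1 * fromBlocks 1 P 0 D = fromBlocks A 0 B (D + B * P) := by
    simp [fromBlocks_multiply, h, add_comm]
  simpa [det_fromBlocks_one₂₂, det_fromBlocks_zero₁₂, det_fromBlocks_zero₂₁] using
    congrArg det hblock

theorem charpoly_sub_mul_mul_charpoly_of_intertwine {A : Matrix W W R} {D : Matrix V V R}
    {P : Matrix W V R} (B : Matrix V W R) (h : A * P = P * D) :
    (A - P * B).charpoly * D.charpoly = A.charpoly * (D - B * P).charpoly := by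
  have hchar : charmatrix A * P.map C = P.map C * charmatrix D := by
    simp only [charmatrix, RingHom.mapMatrix_apply, Matrix.sub_mul, Matrix.mul_sub,
      ← Matrix.map_mul, h, scalar_apply, ← smul_eq_diagonal_mul, ← op_smul_eq_mul_diagonal,
      op_smul_eq_smul]
  have hsub : charmatrix (A - P * B) = charmatrix A + P.map C * B.map C := by
    simp only [charmatrix, map_sub, RingHom.mapMatrix_apply, Matrix.map_mul]; abel
  have hsub' : charmatrix (D - B * P) = charmatrix D + B.map C * P.map C := by
    simp only [charmatrix, map_sub, RingHom.mapMatrix_apply, Matrix.map_mul]; abel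
  simpa only [charpoly, hsub, hsub'] using det_add_mul_mul_det_of_intertwine (B.map C) hchar

theorem roots_charpoly_diagonal [IsDomain R] (f : V → R) :
    (diagonal f).charpoly.roots = univ.val.map f := by
  rw [charpoly_diagonal]
  exact (congrArg roots (by simp)).trans (roots_multiset_prod_X_sub_C (univ.val.map f))

end Charpoly

section SortedMultiset

variable {α : Type*} [LinearOrder α]

theorem sort_getElem?_one_eq_some_iff {s : Multiset α} {x : α} :
    (s.sort (· ≤ ·))[1]? = some x ↔ ∃ a t, s = a ::ₘ x ::ₘ t ∧ a ≤ x ∧ ∀ b ∈ t, x ≤ b := by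
  constructor
  · intro h
    have hcoe := s.sort_eq (· ≤ ·)
    have hsorted := s.pairwise_sort (· ≤ ·)
    match hl : s.sort (· ≤ ·) with
    | [] | [_] => simp [hl] at h
    | a :: b :: l =>
      obtain rfl : b = x := by simpa [hl] using h
      rw [hl, List.pairwise_cons, List.pairwise_cons] at hsorted
      refine ⟨a, l, ?_, hsorted.1 b (by simp), fun c hc => hsorted.2.1 c (by simpa using hc)⟩
      rw [← hcoe, hl, Multiset.cons_coe, Multiset.cons_coe]
  · rintro ⟨a, t, rfl, hax, hxt⟩
    rw [Multiset.sort_cons, Multiset.sort_cons _ _ _ hxt]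
    · simp
    · intro b hb
      rcases Multiset.mem_cons.mp hb with rfl | hb
      exacts [hax, hax.trans (hxt b hb)]

theorem sort_add_getElem?_one {s t : Multiset α} {x : α}
    (hs : (s.sort (· ≤ ·))[1]? = some x) (ht : ∀ b ∈ t, x ≤ b) :
    ((s + t).sort (· ≤ ·))[1]? = some x := by
  obtain ⟨a, u, rfl, hax, hxu⟩ := sort_getElem?_one_eq_some_iff.mp hs
  refine sort_getElem?_one_eq_some_iff.mpr ⟨a, u + t, by simp, hax, fun b hb => ?_⟩
  exact (Multiset.mem_add.mp hb).elim (hxu b) (ht b)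

end SortedMultiset

section Spectrum

variable {V : Type*} [Fintype V] [DecidableEq V] {S : Matrix V V ℝ}

theorem exists_isLargestEigenvalue [Nonempty V] (hS : S.charpoly.Splits) :
    ∃ ρ, IsLargestEigenvalue S ρ := by
  have hroots : S.charpoly.roots.toFinset.Nonempty := by
    rw [Multiset.toFinset_nonempty, ← Multiset.card_pos, ← hS.natDegree_eq_card_roots,
      charpoly_natDegree_eq_dim]
    exact Fintype.card_pos
  exact ⟨_, hS, Multiset.mem_toFinset.mp (max'_mem _ hroots),
    fun y hy => le_max' _ y (Multiset.mem_toFinset.mpr hy)⟩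

theorem exists_isSecondSmallestEigenvalue (hV : 1 < Fintype.card V) (hS : S.charpoly.Splits) :
    ∃ μ, IsSecondSmallestEigenvalue S μ := by
  have hlength : 1 < (S.charpoly.roots.sort (· ≤ ·)).length := by
    rwa [Multiset.length_sort, ← hS.natDegree_eq_card_roots, charpoly_natDegree_eq_dim]
  exact ⟨_, hS, List.getElem?_eq_getElem hlength⟩

theorem eigenvalues_mem_roots_charpoly (hS : S.IsHermitian) (k : V) :
    hS.eigenvalues k ∈ S.charpoly.roots := by
  simp [hS.roots_charpoly_eq_eigenvalues]

theorem dotProduct_eq_sum_eigenvectorBasis (hS : S.IsHermitian) (v w : V → ℝ) :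
    v ⬝ᵥ w = ∑ k, (⇑(hS.eigenvectorBasis k) ⬝ᵥ v) * (⇑(hS.eigenvectorBasis k) ⬝ᵥ w) := by
  have h := hS.eigenvectorBasis.sum_inner_mul_inner (WithLp.toLp 2 v) (WithLp.toLp 2 w)
  simp only [EuclideanSpace.inner_eq_star_dotProduct, star_trivial] at h
  rw [dotProduct_comm, ← h]
  exact sum_congr rfl fun k _ => by rw [dotProduct_comm w]

theorem eigenvectorBasis_dotProduct_mulVec (hS : S.IsHermitian) (k : V) (v : V → ℝ) :
    ⇑(hS.eigenvectorBasis k) ⬝ᵥ S *ᵥ v =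
      hS.eigenvalues k * (⇑(hS.eigenvectorBasis k) ⬝ᵥ v) := by
  have hsymm : Sᵀ = S := by rw [← conjTranspose_eq_transpose_of_trivial, hS.eq]
  rw [dotProduct_mulVec, ← mulVec_transpose, hsymm, hS.mulVec_eigenvectorBasis, smul_dotProduct,
    smul_eq_mul]

theorem mul_self_apply_self_le_of_isHermitian (hS : S.IsHermitian) {ρ : ℝ}
    (hρ : ∀ x ∈ S.charpoly.roots, 0 ≤ x ∧ x ≤ ρ) (i : V) : (S * S) i i ≤ ρ * S i i := by
  have hentry : (S * S) i i = S *ᵥ Pi.single i 1 ⬝ᵥ S *ᵥ Pi.single i 1 := by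
    simp only [mul_apply, mulVec_single_one, dotProduct, col_apply]
    exact sum_congr rfl fun j _ => by rw [← hS.apply i j, star_trivial]
  have hdiag : S i i = Pi.single i 1 ⬝ᵥ S *ᵥ Pi.single i 1 := by simp
  rw [hentry, hdiag, dotProduct_eq_sum_eigenvectorBasis hS,
    dotProduct_eq_sum_eigenvectorBasis hS (Pi.single i 1), mul_sum]
  refine sum_le_sum fun k _ => ?_
  obtain ⟨h0, hle⟩ := hρ _ (eigenvalues_mem_roots_charpoly hS k)
  rw [eigenvectorBasis_dotProduct_mulVec]
  nlinarith [mul_nonneg h0 (sub_nonneg.mpr hle),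
    mul_self_nonneg (⇑(hS.eigenvectorBasis k) ⬝ᵥ Pi.single i 1)]

theorem exists_forall_dotProduct_eq_zero_le (hS : S.IsHermitian) {μ : ℝ}
    (hμ : IsSecondSmallestEigenvalue S μ) :
    ∃ u : V → ℝ, ∀ v, u ⬝ᵥ v = 0 → μ * (v ⬝ᵥ v) ≤ v ⬝ᵥ S *ᵥ v := by
  obtain ⟨a, t, hroots, -, ht⟩ := sort_getElem?_one_eq_some_iff.mp hμ.2
  rw [hS.roots_charpoly_eq_eigenvalues] at hroots
  obtain ⟨i, -, -, hrest⟩ := (Multiset.map_eq_cons _ _ _ _).mpr hroots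
  have hmin : ∀ k ≠ i, μ ≤ hS.eigenvalues k := fun k hk => by
    have hmem := Multiset.mem_map_of_mem (RCLike.ofReal ∘ hS.eigenvalues : V → ℝ)
      ((Multiset.mem_erase_of_ne hk).mpr (mem_univ_val k))
    rw [hrest, Multiset.mem_cons] at hmem
    exact hmem.elim ge_of_eq (ht _)
  refine ⟨⇑(hS.eigenvectorBasis i), fun v hv => ?_⟩
  simp only [dotProduct_eq_sum_eigenvectorBasis hS v, eigenvectorBasis_dotProduct_mulVec, mul_sum]
  refine sum_le_sum fun k _ => ?_
  rcases eq_or_ne k i with rfl | hk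
  · simp [hv]
  · nlinarith [hmin k hk, mul_self_nonneg (⇑(hS.eigenvectorBasis k) ⬝ᵥ v)]

end Spectrum

section DetailedBalance

variable {V : Type*} [Fintype V] [DecidableEq V] {m : V → ℝ} {A : Matrix V V ℝ}

/-- Detailed balance: `A` is self-adjoint for the inner product `∑ i, m i * f i * g i`. -/
def DetailedBalance (m : V → ℝ) (A : Matrix V V ℝ) : Prop :=
  ∀ i j, m i * A i j = m j * A j i

/-- The conjugate `M^{1/2} A M^{-1/2}` of `A`, where `M` is the diagonal matrix of the positive
weights `m`; it is symmetric when `A` satisfies detailed balance. -/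
noncomputable def symmetrization (m : V → ℝ) (A : Matrix V V ℝ) : Matrix V V ℝ :=
  diagonal (fun i => √(m i)) * A * diagonal (fun i => (√(m i))⁻¹)

theorem symmetrization_apply (i j : V) :
    symmetrization m A i j = √(m i) * A i j * (√(m j))⁻¹ := by
  rw [symmetrization, mul_diagonal, diagonal_mul]

theorem diagonal_sqrt_inv_mul_diagonal_sqrt (hm : ∀ i, 0 < m i) :
    diagonal (fun i => (√(m i))⁻¹) * diagonal (fun i => √(m i)) = 1 := by
  simp [diagonal_mul_diagonal, (Real.sqrt_pos.mpr (hm _)).ne']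

theorem symmetrization_apply_self (hm : ∀ i, 0 < m i) (i : V) :
    symmetrization m A i i = A i i := by
  have := Real.sqrt_pos.mpr (hm i)
  rw [symmetrization_apply]
  field_simp

theorem charpoly_symmetrization (hm : ∀ i, 0 < m i) :
    (symmetrization m A).charpoly = A.charpoly := by
  rw [symmetrization, charpoly_mul_comm, ← Matrix.mul_assoc,
    diagonal_sqrt_inv_mul_diagonal_sqrt hm, Matrix.one_mul]

theorem symmetrization_mul_self (hm : ∀ i, 0 < m i) :
    symmetrization m (A * A) = symmetrization m A * symmetrization m A := by
  have hinv := diagonal_sqrt_inv_mul_diagonal_sqrt hm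
  simp only [symmetrization, Matrix.mul_assoc]
  rw [← Matrix.mul_assoc (diagonal fun i => (√(m i))⁻¹) (diagonal fun i => √(m i)), hinv,
    Matrix.one_mul]

theorem DetailedBalance.isHermitian_symmetrization (hA : DetailedBalance m A)
    (hm : ∀ i, 0 < m i) : (symmetrization m A).IsHermitian := by
  refine IsHermitian.ext fun i j => ?_
  have hi := Real.sqrt_pos.mpr (hm i)
  have hj := Real.sqrt_pos.mpr (hm j)
  rw [star_trivial, symmetrization_apply, symmetrization_apply, ← div_eq_mul_inv,
    ← div_eq_mul_inv, div_eq_div_iff hi.ne' hj.ne']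
  linear_combination hA j i - A i j * Real.mul_self_sqrt (hm i).le
    + A j i * Real.mul_self_sqrt (hm j).le

theorem symmetrization_mulVec (hm : ∀ i, 0 < m i) (f : V → ℝ) :
    symmetrization m A *ᵥ (diagonal (fun i => √(m i)) *ᵥ f) =
      diagonal (fun i => √(m i)) *ᵥ (A *ᵥ f) := by
  rw [symmetrization, mulVec_mulVec, Matrix.mul_assoc, diagonal_sqrt_inv_mul_diagonal_sqrt hm,
    Matrix.mul_one, mulVec_mulVec]

theorem DetailedBalance.splits_charpoly (hA : DetailedBalance m A) (hm : ∀ i, 0 < m i) :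
    A.charpoly.Splits :=
  charpoly_symmetrization hm ▸ (hA.isHermitian_symmetrization hm).splits_charpoly

theorem DetailedBalance.mul_self_apply_self_le (hA : DetailedBalance m A) (hm : ∀ i, 0 < m i)
    {ρ : ℝ} (hρ : ∀ x ∈ A.charpoly.roots, 0 ≤ x ∧ x ≤ ρ) (i : V) :
    (A * A) i i ≤ ρ * A i i := by
  have h := mul_self_apply_self_le_of_isHermitian (hA.isHermitian_symmetrization hm) (ρ := ρ)
    (by rwa [charpoly_symmetrization hm]) i
  rwa [← symmetrization_mul_self hm, symmetrization_apply_self hm,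
    symmetrization_apply_self hm] at h

theorem diagonal_sqrt_mulVec_dotProduct (hm : ∀ i, 0 < m i) (f g : V → ℝ) :
    (diagonal (fun i => √(m i)) *ᵥ f) ⬝ᵥ (diagonal (fun i => √(m i)) *ᵥ g) =
      ∑ i, m i * (f i * g i) := by
  refine sum_congr rfl fun i _ => ?_
  rw [mulVec_diagonal, mulVec_diagonal]
  linear_combination f i * g i * Real.mul_self_sqrt (hm i).le

theorem DetailedBalance.secondSmallest_le_of_forall_mem (hA : DetailedBalance m A)
    (hm : ∀ i, 0 < m i) {μ x : ℝ} (hμ : IsSecondSmallestEigenvalue A μ)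
    {U : Submodule ℝ (V → ℝ)} (hU : 1 < Module.finrank ℝ U)
    (hx : ∀ h ∈ U, ∑ i, m i * (h i * (A *ᵥ h) i) ≤ x * ∑ i, m i * (h i * h i)) : μ ≤ x := by
  set D : Matrix V V ℝ := diagonal fun i => √(m i)
  obtain ⟨u, hu⟩ := exists_forall_dotProduct_eq_zero_le (hA.isHermitian_symmetrization hm)
    (μ := μ) (by rwa [IsSecondSmallestEigenvalue, charpoly_symmetrization hm])
  obtain ⟨h, horth, hne⟩ := Submodule.exists_mem_ne_zero_of_ne_bot <|
    LinearMap.ker_ne_bot_of_finrank_lt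
      (f := (dotProductBilin ℝ ℝ (u ᵥ* D)).comp U.subtype) (by simpa using hU)
  have horth' : u ⬝ᵥ D *ᵥ (h : V → ℝ) = 0 := by
    rw [dotProduct_mulVec]
    exact horth
  have hle := hu _ horth'
  rw [symmetrization_mulVec hm, diagonal_sqrt_mulVec_dotProduct hm,
    diagonal_sqrt_mulVec_dotProduct hm] at hle
  have hpos : 0 < ∑ i, m i * ((h : V → ℝ) i * (h : V → ℝ) i) := by
    obtain ⟨i, hi⟩ := Function.ne_iff.mp (Subtype.coe_ne_coe.mpr hne)
    exact sum_pos' (fun j _ => mul_nonneg (hm j).le (mul_self_nonneg _))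
      ⟨i, mem_univ i, mul_pos (hm i) (mul_self_pos.mpr hi)⟩
  exact le_of_mul_le_mul_right (hle.trans (hx h h.2)) hpos

end DetailedBalance

section WeightedLaplacian

variable {V : Type*} [Fintype V] [DecidableEq V] {G : SimpleGraph V} [DecidableRel G.Adj]
  {m : V → ℝ}

theorem weightedLaplacian_apply_self (d : V) :
    weightedLaplacian G m d d = ∑ e ∈ G.neighborFinset d, m e := by
  simp [weightedLaplacian]

theorem weightedLaplacian_apply_of_ne {d e : V} (h : d ≠ e) :
    weightedLaplacian G m d e = if G.Adj d e then -m e else 0 := by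
  simp [weightedLaplacian, h]

theorem weightedLaplacian_mulVec_apply (f : V → ℝ) (d : V) :
    (weightedLaplacian G m *ᵥ f) d = ∑ e ∈ G.neighborFinset d, m e * (f d - f e) := by
  have hoff : ∀ e ∈ ({d}ᶜ : Finset V), weightedLaplacian G m d e * f e =
      if G.Adj d e then -(m e * f e) else 0 := fun e he => by
    rw [weightedLaplacian_apply_of_ne (by simpa [eq_comm] using he), ite_mul, zero_mul, neg_mul]
  have hfilter : ({d}ᶜ : Finset V).filter (G.Adj d) = G.neighborFinset d := by
    ext e
    simpa using fun h => (G.ne_of_adj h).symm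
  rw [mulVec, dotProduct, Fintype.sum_eq_add_sum_compl d, sum_congr rfl hoff, ← sum_filter,
    hfilter, weightedLaplacian_apply_self, sum_mul, ← sum_add_distrib]
  exact sum_congr rfl fun e _ => by ring

theorem lapMatrix_eq_weightedLaplacian :
    G.lapMatrix ℝ = weightedLaplacian G 1 := by
  ext d e
  rcases eq_or_ne d e with rfl | h
  · simp [SimpleGraph.lapMatrix, SimpleGraph.degMatrix, weightedLaplacian_apply_self]
  · simp [SimpleGraph.lapMatrix, SimpleGraph.degMatrix, SimpleGraph.adjMatrix_apply,
      weightedLaplacian_apply_of_ne h, h, apply_ite]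

theorem splits_charpoly_lapMatrix : (G.lapMatrix ℝ).charpoly.Splits :=
  (SimpleGraph.posSemidef_lapMatrix ℝ G).isHermitian.splits_charpoly

theorem nonneg_of_mem_roots_charpoly_lapMatrix {x : ℝ}
    (hx : x ∈ (G.lapMatrix ℝ).charpoly.roots) : 0 ≤ x := by
  have hL := SimpleGraph.posSemidef_lapMatrix ℝ G
  rw [hL.isHermitian.roots_charpoly_eq_eigenvalues, Multiset.mem_map] at hx
  obtain ⟨i, -, rfl⟩ := hx
  exact hL.eigenvalues_nonneg i

theorem detailedBalance_weightedLaplacian : DetailedBalance m (weightedLaplacian G m) := by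
  intro d e
  rcases eq_or_ne d e with rfl | h
  · rfl
  · simp only [weightedLaplacian_apply_of_ne h, weightedLaplacian_apply_of_ne h.symm,
      G.adj_comm e d]
    split_ifs <;> ring

theorem weightedLaplacian_mul_self_apply_self (d : V) :
    (weightedLaplacian G m * weightedLaplacian G m) d d =
      (m d + ∑ e ∈ G.neighborFinset d, m e) * ∑ e ∈ G.neighborFinset d, m e := by
  have hcol : (weightedLaplacian G m * weightedLaplacian G m) d d =
      (weightedLaplacian G m *ᵥ fun e => weightedLaplacian G m e d) d := rfl
  rw [hcol, weightedLaplacian_mulVec_apply, mul_sum]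
  refine sum_congr rfl fun e he => ?_
  have hadj : G.Adj e d := ((G.mem_neighborFinset d e).mp he).symm
  rw [weightedLaplacian_apply_of_ne hadj.ne, if_pos hadj, weightedLaplacian_apply_self]
  ring

theorem add_sum_neighborFinset_le_of_mem_roots (hm : ∀ d, 0 < m d) {ρ : ℝ}
    (hρ : ∀ x ∈ (weightedLaplacian G m).charpoly.roots, 0 ≤ x ∧ x ≤ ρ) {d e : V}
    (hde : G.Adj d e) : m d + ∑ e ∈ G.neighborFinset d, m e ≤ ρ := by
  have hpos : 0 < ∑ e ∈ G.neighborFinset d, m e :=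
    sum_pos (fun e _ => hm e) ⟨e, (G.mem_neighborFinset d e).mpr hde⟩
  have h := detailedBalance_weightedLaplacian.mul_self_apply_self_le hm hρ d
  rw [weightedLaplacian_mul_self_apply_self, weightedLaplacian_apply_self] at h
  exact le_of_mul_le_mul_right h hpos

theorem mul_weightedLaplacian_mulVec_apply_le (hm : ∀ d, 0 ≤ m d) {p q : V}
    (hpq : G.neighborFinset p = {q}) {h : V → ℝ} {b : ℝ} (hq : h q = 0)
    (hb : ∀ d, d ≠ p → d ≠ q → h d = b) (d : V) :
    h d * (weightedLaplacian G m *ᵥ h) d ≤ m q * (h d * h d) := by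
  rw [weightedLaplacian_mulVec_apply, mul_sum]
  by_cases hdq : d = q
  · simp [hdq, hq]
  by_cases hdp : d = p
  · subst hdp
    rw [hpq, sum_singleton, hq]
    linarith
  have hterm : ∀ e ∈ G.neighborFinset d,
      h d * (m e * (h d - h e)) = if e = q then m q * (h d * h d) else 0 := fun e he => by
    have hep : e ≠ p := by
      rintro rfl
      have hadj := ((G.mem_neighborFinset d e).mp he).symm
      exact hdq (by simpa [hpq] using (G.mem_neighborFinset e d).mpr hadj)
    split_ifs with heq
    · rw [heq, hq]
      ring
    · rw [hb d hdp hdq, hb e hep heq]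
      ring
  rw [sum_congr rfl hterm, sum_ite_eq']
  split_ifs
  exacts [le_rfl, mul_nonneg (hm q) (mul_self_nonneg _)]

theorem secondSmallest_le_of_neighborFinset_eq_singleton (hm : ∀ d, 0 < m d) {μ : ℝ}
    (hμ : IsSecondSmallestEigenvalue (weightedLaplacian G m) μ) {p q r : V}
    (hpq : G.neighborFinset p = {q}) (hrp : r ≠ p) (hrq : r ≠ q) : μ ≤ m q := by
  have hqp : q ≠ p := by
    have hadj : G.Adj p q := (G.mem_neighborFinset p q).mp (by simp [hpq])
    exact hadj.ne'
  -- The test space consists of the functions that vanish at `q` and are constant off `{p, q}`.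
  set f : V → ℝ := Pi.single p 1
  set g : V → ℝ := fun d => if d = p ∨ d = q then 0 else 1
  have hfg : LinearIndependent ℝ ![f, g] := LinearIndependent.pair_iff.mpr fun a b hab => by
    have hp := congrFun hab p
    have hr := congrFun hab r
    simp_all [f, g]
  refine detailedBalance_weightedLaplacian.secondSmallest_le_of_forall_mem hm hμ
    (U := Submodule.span ℝ (Set.range ![f, g]))
    (by simp [finrank_span_eq_card hfg]) fun h hh => ?_
  rw [range_cons_cons_empty, Submodule.mem_span_pair] at hh
  obtain ⟨a, b, rfl⟩ := hh
  rw [mul_sum]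
  refine sum_le_sum fun d _ => ?_
  have hle := mul_weightedLaplacian_mulVec_apply_le (m := m) (fun d => (hm d).le) hpq
    (h := a • f + b • g) (b := b) (by simp [f, g, hqp])
    (fun d hdp hdq => by simp [f, g, hdp, hdq]) d
  exact (mul_le_mul_of_nonneg_left hle (hm d).le).trans_eq (mul_left_comm _ _ _)

end WeightedLaplacian

section Relation

variable {W : Type*} [Fintype W] {R : W → W → Prop} [DecidableRel R] {G : SimpleGraph W}
  [DecidableRel G.Adj] {m : W → ℝ}

/-- The total weight of the vertices related to `d`, including `d` itself if `R d d`. -/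
def relWeight (R : W → W → Prop) [DecidableRel R] (m : W → ℝ) (d : W) : ℝ :=
  ∑ e with R d e, m e

/-- The 0-1 matrix of a relation. -/
def relMatrix (R : W → W → Prop) [DecidableRel R] : Matrix W W ℝ :=
  Matrix.of fun d e => if R d e then 1 else 0

theorem relWeight_le_add_sum_neighborFinset (hm : ∀ d, 0 ≤ m d)
    (hG : ∀ d e, G.Adj d e ↔ d ≠ e ∧ R d e) (d : W) :
    relWeight R m d ≤ m d + ∑ e ∈ G.neighborFinset d, m e := by
  classical
  rw [relWeight, ← sum_insert (by simp)]
  refine sum_le_sum_of_subset_of_nonneg (fun e he => ?_) fun e _ _ => hm e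
  rw [mem_insert, G.mem_neighborFinset, hG]
  exact or_iff_not_imp_left.mpr fun hed => ⟨Ne.symm hed, (mem_filter.mp he).2⟩

theorem weightedLaplacian_eq_diagonal_sub [DecidableEq W]
    (hG : ∀ d e, G.Adj d e ↔ d ≠ e ∧ R d e) :
    weightedLaplacian G m = diagonal (relWeight R m) - relMatrix R * diagonal m := by
  ext d e
  rw [Matrix.sub_apply, mul_diagonal]
  rcases eq_or_ne d e with rfl | h
  · have hnbr : G.neighborFinset d = ({e | R d e} : Finset W).erase d := by
      ext e
      simp [hG, eq_comm]
    rw [weightedLaplacian_apply_self, hnbr, diagonal_apply_eq]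
    by_cases hd : R d d
    · simp [relMatrix, relWeight, hd, ← sum_erase_eq_sub]
    · simp [relMatrix, relWeight, hd]
  · rw [weightedLaplacian_apply_of_ne h, diagonal_apply_ne _ h]
    by_cases hR : R d e <;> simp [hG, relMatrix, h, hR]

end Relation

section GeneralizedJoin

variable {V W : Type*} [Fintype V] [DecidableEq W] {R : W → W → Prop} {c : V → W}
  {H : SimpleGraph V} {G : SimpleGraph W}

/-- `H` is a generalized join over `G`: its vertices are grouped into nonempty classes, indexed by
the vertices of `G` via `c`, and whether two distinct vertices are adjacent depends only on their
classes. The relation `R` agrees with adjacency in `G` off the diagonal; on the diagonal it tells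
the classes that induce complete graphs from those that induce null graphs. -/
structure IsGeneralizedJoin (R : W → W → Prop) (c : V → W) (H : SimpleGraph V)
    (G : SimpleGraph W) : Prop where
  surjective : Function.Surjective c
  base_adj : ∀ d e, G.Adj d e ↔ d ≠ e ∧ R d e
  adj : ∀ x y, H.Adj x y ↔ x ≠ y ∧ R (c x) (c y)

/-- The number of vertices in the class `d`, as a real number because it serves as the weight of
`d`. -/
def classCard (c : V → W) (d : W) : ℝ := #{x | c x = d}

theorem IsGeneralizedJoin.classCard_pos (h : IsGeneralizedJoin R c H G) (d : W) :
    0 < classCard c d := by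
  obtain ⟨x, hx⟩ := h.surjective d
  exact Nat.cast_pos.mpr (card_pos.mpr ⟨x, by simpa using hx⟩)

variable [Fintype W]

theorem sum_comp_eq_sum_mul_classCard (f : W → ℝ) :
    ∑ x, f (c x) = ∑ d, f d * classCard c d := by
  rw [← sum_fiberwise' univ c f]
  exact sum_congr rfl fun d _ => by rw [sum_const, nsmul_eq_mul, mul_comm, classCard]

theorem relWeight_comp [DecidableRel R] (x : V) :
    relWeight (fun x y => R (c x) (c y)) 1 x = relWeight R (classCard c) (c x) := by
  simp only [relWeight, sum_filter, Pi.one_apply]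
  rw [sum_comp_eq_sum_mul_classCard fun d => if R (c x) d then (1 : ℝ) else 0]
  simp only [ite_mul, one_mul, zero_mul]

variable [DecidableEq V] [DecidableRel H.Adj] [DecidableRel G.Adj]

theorem IsGeneralizedJoin.charpoly_lapMatrix_mul [DecidableRel R]
    (h : IsGeneralizedJoin R c H G) :
    (H.lapMatrix ℝ).charpoly * (diagonal (relWeight R (classCard c))).charpoly =
      (diagonal (relWeight R (classCard c) ∘ c)).charpoly *
        (weightedLaplacian G (classCard c)).charpoly := by
  set P : Matrix V W ℝ := (1 : Matrix W W ℝ).submatrix c id with hP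
  set B : Matrix W V ℝ := (relMatrix R).submatrix id c with hB
  have hPB : P * B = relMatrix fun x y => R (c x) (c y) := by
    rw [hP, hB, ← submatrix_mul _ _ _ _ _ Function.bijective_id, Matrix.one_mul]
    rfl
  have hBP : B * P = relMatrix R * diagonal (classCard c) := by
    ext d e
    rw [mul_diagonal, mul_apply]
    refine (sum_comp_eq_sum_mul_classCard
      fun d' => relMatrix R d d' * (1 : Matrix W W ℝ) d' e).trans ?_
    simp [one_apply]
  have hL : H.lapMatrix ℝ = diagonal (relWeight R (classCard c) ∘ c) - P * B := by
    rw [lapMatrix_eq_weightedLaplacian, weightedLaplacian_eq_diagonal_sub h.adj, hPB,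
      diagonal_one', Matrix.mul_one, _root_.funext relWeight_comp, Function.comp_def]
  rw [hL, weightedLaplacian_eq_diagonal_sub h.base_adj, ← hBP]
  refine charpoly_sub_mul_mul_charpoly_of_intertwine B ?_
  ext x d
  by_cases hx : c x = d <;> simp [hP, one_apply, hx]

theorem IsGeneralizedJoin.exists_roots_charpoly_lapMatrix [DecidableRel R]
    (h : IsGeneralizedJoin R c H G) :
    ∃ s : Multiset W, (H.lapMatrix ℝ).charpoly.roots =
      (weightedLaplacian G (classCard c)).charpoly.roots +
        s.map (relWeight R (classCard c)) := by
  have hle : (univ : Finset W).val ≤ (univ : Finset V).val.map c :=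
    (Multiset.le_iff_subset univ.nodup).mpr fun d _ =>
      Multiset.mem_map.mpr ((h.surjective d).imp fun x hx => ⟨mem_univ_val x, hx⟩)
  obtain ⟨s, hs⟩ := Multiset.le_iff_exists_add.mp hle
  have hroots := congrArg roots h.charpoly_lapMatrix_mul
  rw [roots_mul (mul_ne_zero (charpoly_monic _).ne_zero (charpoly_monic _).ne_zero),
    roots_mul (mul_ne_zero (charpoly_monic _).ne_zero (charpoly_monic _).ne_zero),
    roots_charpoly_diagonal, roots_charpoly_diagonal, ← Multiset.map_map, hs,
    Multiset.map_add] at hroots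
  exact ⟨s, add_right_cancel (hroots.trans (by abel))⟩

theorem IsGeneralizedJoin.isAlgebraicConnectivity [DecidableRel R]
    (h : IsGeneralizedJoin R c H G) {μ : ℝ}
    (hμ : IsSecondSmallestEigenvalue (weightedLaplacian G (classCard c)) μ)
    (hle : ∀ d, μ ≤ relWeight R (classCard c) d) : IsAlgebraicConnectivity H μ := by
  obtain ⟨s, hs⟩ := h.exists_roots_charpoly_lapMatrix
  refine ⟨splits_charpoly_lapMatrix, ?_⟩
  rw [hs]
  refine sort_add_getElem?_one hμ.2 fun x hx => ?_
  obtain ⟨d, -, rfl⟩ := Multiset.mem_map.mp hx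
  exact hle d

theorem IsGeneralizedJoin.isLaplacianSpectralRadius (h : IsGeneralizedJoin R c H G) {ρ : ℝ}
    (hρ : IsLargestEigenvalue (weightedLaplacian G (classCard c)) ρ)
    (hG : ∀ d, ∃ e, G.Adj d e) : IsLaplacianSpectralRadius H ρ := by
  classical
  obtain ⟨s, hs⟩ := h.exists_roots_charpoly_lapMatrix
  have hbounds : ∀ x ∈ (weightedLaplacian G (classCard c)).charpoly.roots,
      0 ≤ x ∧ x ≤ ρ := fun x hx =>
    ⟨nonneg_of_mem_roots_charpoly_lapMatrix (hs ▸ Multiset.mem_add.mpr (.inl hx)), hρ.2.2 hx⟩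
  refine ⟨splits_charpoly_lapMatrix, hs ▸ Multiset.mem_add.mpr (.inl hρ.2.1), fun x hx => ?_⟩
  rcases Multiset.mem_add.mp (hs ▸ hx) with hx | hx
  · exact (hbounds x hx).2
  · obtain ⟨d, -, rfl⟩ := Multiset.mem_map.mp hx
    obtain ⟨e, hde⟩ := hG d
    have hclass : ∀ d, 0 < classCard c d := h.classCard_pos
    exact (relWeight_le_add_sum_neighborFinset (fun d => (hclass d).le) h.base_adj d).trans
      (add_sum_neighborFinset_le_of_mem_roots hclass hbounds hde)

end GeneralizedJoin

namespace ProperDivisor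

variable {n : ℕ}

theorem one_lt (d : ProperDivisor n) : 1 < (d : ℕ) :=
  (mem_Ioo.mp (mem_filter.mp d.2).1).1

theorem lt (d : ProperDivisor n) : (d : ℕ) < n :=
  (mem_Ioo.mp (mem_filter.mp d.2).1).2

theorem dvd (d : ProperDivisor n) : (d : ℕ) ∣ n :=
  (mem_filter.mp d.2).2

/-- The proper divisor `n / d` complementary to `d`. -/
def codivisor (d : ProperDivisor n) : ProperDivisor n :=
  ⟨n / d, by
    have hmul := Nat.mul_div_cancel' d.dvd
    have hlt := d.lt
    have hone : 1 < n / d := Nat.lt_of_mul_lt_mul_left (a := (d : ℕ)) (by omega)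
    simp [hone, Nat.div_lt_self (by omega : 0 < n) d.one_lt, Nat.div_dvd_of_dvd d.dvd]⟩

theorem mul_codivisor (d : ProperDivisor n) : (d : ℕ) * (codivisor d : ℕ) = n :=
  Nat.mul_div_cancel' d.dvd

theorem div_codivisor (d : ProperDivisor n) : n / (codivisor d : ℕ) = d :=
  Nat.div_div_self d.dvd (Nat.ne_of_gt (d.one_lt.trans d.lt).pos)

theorem totient_div_pos (d : ProperDivisor n) : 0 < (n / (d : ℕ)).totient :=
  Nat.totient_pos.mpr (Nat.zero_lt_of_lt (codivisor d).one_lt)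

/-- A prime divisor of an integer that is not a prime power, as a proper divisor. -/
def ofPrime [NeZero n] (hn : ¬ IsPrimePow n) {p : ℕ} (hp : p.Prime) (hpn : p ∣ n) :
    ProperDivisor n :=
  ⟨p, by
    have hne : p ≠ n := fun h => hn (h ▸ hp.isPrimePow)
    simp [hp.one_lt, hpn, (Nat.le_of_dvd (NeZero.pos n) hpn).lt_of_ne hne]⟩

/-- The least prime factor of `d`, as a proper divisor. -/
def minFac (d : ProperDivisor n) : ProperDivisor n :=
  ⟨(d : ℕ).minFac, by
    have hle := Nat.minFac_le (Nat.zero_lt_of_lt d.one_lt)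
    simp [(Nat.minFac_prime d.one_lt.ne').one_lt, hle.trans_lt d.lt,
      (Nat.minFac_dvd (d : ℕ)).trans d.dvd]⟩

theorem prime_minFac (d : ProperDivisor n) : (minFac d : ℕ).Prime :=
  Nat.minFac_prime d.one_lt.ne'

theorem dvd_mul_codivisor_minFac (d : ProperDivisor n) :
    n ∣ (d : ℕ) * (codivisor (minFac d) : ℕ) := by
  nth_rewrite 1 [← mul_codivisor (minFac d)]
  exact mul_dvd_mul_right (Nat.minFac_dvd d) _

theorem dvd_prime_mul_iff {p : ProperDivisor n} (hp : (p : ℕ).Prime) {e : ProperDivisor n} :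
    n ∣ (p : ℕ) * (e : ℕ) ↔ e = codivisor p := by
  have hmul := mul_codivisor p
  refine ⟨fun h => ?_, ?_⟩
  · obtain ⟨t, ht⟩ : (codivisor p : ℕ) ∣ e :=
      Nat.dvd_of_mul_dvd_mul_left hp.pos (hmul.dvd.trans h)
    have htp : t ∣ p := by
      refine Nat.dvd_of_mul_dvd_mul_left (Nat.zero_lt_of_lt (codivisor p).one_lt) ?_
      rw [← ht, mul_comm, hmul]
      exact e.dvd
    rcases (Nat.dvd_prime hp).mp htp with rfl | rfl
    · exact Subtype.ext (ht.trans (mul_one _))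
    · exact absurd (ht.trans ((mul_comm _ _).trans hmul)) e.lt.ne
  · rintro rfl
    exact hmul.symm.dvd

theorem codivisor_ne_of_prime (hn : ¬ IsPrimePow n) {p : ProperDivisor n}
    (hp : (p : ℕ).Prime) : codivisor p ≠ p := fun h => by
  have hmul := mul_codivisor p
  rw [h, ← sq] at hmul
  exact hn ((isPrimePow_nat_iff n).mpr ⟨p, 2, hp, two_pos, hmul⟩)

theorem divisorGraph_neighborFinset_of_prime (hn : ¬ IsPrimePow n) {p : ProperDivisor n}
    (hp : (p : ℕ).Prime) : (divisorGraph n).neighborFinset p = {codivisor p} := by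
  ext e
  rw [SimpleGraph.mem_neighborFinset, mem_singleton, ← dvd_prime_mul_iff hp]
  refine ⟨And.right, fun h => ⟨?_, h⟩⟩
  rintro rfl
  exact codivisor_ne_of_prime hn hp ((dvd_prime_mul_iff hp).mp h).symm

theorem exists_divisorGraph_adj (hn : ¬ IsPrimePow n) (d : ProperDivisor n) :
    ∃ e, (divisorGraph n).Adj d e := by
  by_cases h : d = codivisor (minFac d)
  · refine ⟨minFac d, fun h' => ?_, ?_⟩
    · exact codivisor_ne_of_prime hn (prime_minFac d) (h.symm.trans h')
    · rw [mul_comm]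
      exact (dvd_prime_mul_iff (prime_minFac d)).mpr h
  · exact ⟨codivisor (minFac d), h, dvd_mul_codivisor_minFac d⟩

theorem exists_ne_ne_codivisor [NeZero n] (hn : ¬ IsPrimePow n)
    (hn' : ¬ ∃ p q : ℕ, p.Prime ∧ q.Prime ∧ p ≠ q ∧ n = p * q) {p : ProperDivisor n}
    (hp : (p : ℕ).Prime) : ∃ r, r ≠ p ∧ r ≠ codivisor p := by
  obtain ⟨q, hq, hqn, hqp⟩ : ∃ q : ℕ, q.Prime ∧ q ∣ n ∧ q ≠ p := by
    by_contra! h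
    exact hn (isPrimePow_iff_unique_prime_dvd.mpr
      ⟨p, ⟨hp, p.dvd⟩, fun q hq => h q hq.1 hq.2⟩)
  refine ⟨ofPrime hn hq hqn, fun h => hqp (congrArg Subtype.val h), fun h => ?_⟩
  have hmul := mul_codivisor p
  rw [← h] at hmul
  exact hn' ⟨p, q, hp, hq, hqp.symm, hmul.symm⟩

end ProperDivisor

section ZeroDivisor

variable {n : ℕ}

theorem exists_zeroDivisor_val_eq {k : ℕ} (hk : k < n) {d : ProperDivisor n}
    (hd : n.gcd k = d) : ∃ x : ZeroDivisor (ZMod n), x.1.val = k := by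
  refine ⟨⟨(k : ZMod n), ?_, ((d.codivisor : ℕ) : ZMod n), ?_, ?_⟩, ZMod.val_cast_of_lt hk⟩
  · rw [Ne, ZMod.natCast_eq_zero_iff]
    exact fun h => d.lt.ne (hd.symm.trans (Nat.gcd_eq_left h))
  · rw [Ne, ZMod.natCast_eq_zero_iff]
    exact Nat.not_dvd_of_pos_of_lt (Nat.zero_lt_of_lt d.codivisor.one_lt) d.codivisor.lt
  · rw [← Nat.cast_mul, ZMod.natCast_eq_zero_iff]
    nth_rewrite 1 [← d.mul_codivisor]
    exact mul_dvd_mul_right (hd ▸ Nat.gcd_dvd_right n k) _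

variable [NeZero n]

theorem gcd_val_mem_Ioo (x : ZeroDivisor (ZMod n)) : n.gcd x.1.val ∈ Ioo 1 n := by
  obtain ⟨x, hx0, y, hy0, hxy⟩ := x
  change n.gcd x.val ∈ Ioo 1 n
  have hn : 0 < n := NeZero.pos n
  have hne_one : n.gcd x.val ≠ 1 := fun h => by
    have hunit : IsUnit x := by
      rw [← ZMod.natCast_zmod_val x, ZMod.isUnit_iff_coprime]
      exact Nat.Coprime.symm h
    exact hy0 (hunit.mul_right_eq_zero.mp hxy)
  have hne_n : n.gcd x.val ≠ n := fun h =>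
    hx0 ((ZMod.val_eq_zero x).mp
      (Nat.eq_zero_of_dvd_of_lt (Nat.gcd_eq_left_iff_dvd.mp h) (ZMod.val_lt x)))
  have hpos := Nat.gcd_pos_of_pos_left x.val hn
  exact mem_Ioo.mpr ⟨by omega, (Nat.gcd_le_left _ hn).lt_of_ne hne_n⟩

/-- The proper divisor `gcd(n, x)` attached to a zero divisor `x` of `ZMod n`. -/
def zeroDivisorClass (x : ZeroDivisor (ZMod n)) : ProperDivisor n :=
  ⟨n.gcd x.1.val, mem_filter.mpr ⟨gcd_val_mem_Ioo x, Nat.gcd_dvd_left _ _⟩⟩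

theorem card_zeroDivisorClass_eq (d : ProperDivisor n) :
    #{x : ZeroDivisor (ZMod n) | zeroDivisorClass x = d} = (n / (d : ℕ)).totient := by
  rw [Nat.totient_div_of_dvd d.dvd]
  refine card_bij (fun x _ => x.1.val) (fun x hx => ?_)
    (fun x _ y _ h => Subtype.ext (ZMod.val_injective n h)) fun k hk => ?_
  · exact mem_filter.mpr ⟨mem_range.mpr (ZMod.val_lt _), congrArg Subtype.val (mem_filter.mp hx).2⟩
  · obtain ⟨hkn, hkd⟩ := mem_filter.mp hk
    obtain ⟨x, rfl⟩ := exists_zeroDivisor_val_eq (mem_range.mp hkn) hkd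
    exact ⟨x, mem_filter.mpr ⟨mem_univ x, Subtype.ext hkd⟩, rfl⟩

theorem classCard_zeroDivisorClass (d : ProperDivisor n) :
    classCard (zeroDivisorClass (n := n)) d = (n / (d : ℕ)).totient :=
  congrArg Nat.cast (card_zeroDivisorClass_eq d)

theorem divisorLaplacian_eq_weightedLaplacian :
    divisorLaplacian n = weightedLaplacian (divisorGraph n) (classCard zeroDivisorClass) := by
  rw [divisorLaplacian, _root_.funext classCard_zeroDivisorClass]

theorem isGeneralizedJoin_zeroDivisorClass :
    IsGeneralizedJoin (fun d e : ProperDivisor n => n ∣ (d : ℕ) * (e : ℕ)) zeroDivisorClass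
      (zeroDivisorGraph (ZMod n)) (divisorGraph n) where
  surjective d := by
    obtain ⟨x, hx⟩ := card_pos.mp ((card_zeroDivisorClass_eq d).symm ▸ d.totient_div_pos)
    exact ⟨x, (mem_filter.mp hx).2⟩
  base_adj _ _ := Iff.rfl
  adj x y := and_congr_right fun _ => by
    change _ ↔ n ∣ n.gcd x.1.val * n.gcd y.1.val
    rw [Nat.dvd_gcd_mul_gcd_iff_dvd_mul, ← ZMod.natCast_eq_zero_iff, Nat.cast_mul,
      ZMod.natCast_zmod_val, ZMod.natCast_zmod_val]

theorem totient_minFac_le_relWeight (d : ProperDivisor n) :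
    (n.minFac.totient : ℝ) ≤
      relWeight (fun d e : ProperDivisor n => n ∣ (d : ℕ) * (e : ℕ)) (classCard zeroDivisorClass)
        d := by
  have hp := d.prime_minFac
  have hcodivisor : (n.minFac.totient : ℝ) ≤ classCard zeroDivisorClass d.minFac.codivisor := by
    rw [classCard_zeroDivisorClass, ProperDivisor.div_codivisor, Nat.totient_prime hp,
      Nat.totient_prime (Nat.minFac_prime (d.one_lt.trans d.lt).ne')]
    exact_mod_cast Nat.sub_le_sub_right (Nat.minFac_le_of_dvd hp.two_le d.minFac.dvd) 1
  exact hcodivisor.trans (single_le_sum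
    (fun e _ => (isGeneralizedJoin_zeroDivisorClass.classCard_pos e).le)
    (mem_filter.mpr ⟨mem_univ _, d.dvd_mul_codivisor_minFac⟩))

theorem splits_charpoly_divisorLaplacian : (divisorLaplacian n).charpoly.Splits := by
  rw [divisorLaplacian_eq_weightedLaplacian]
  exact detailedBalance_weightedLaplacian.splits_charpoly
    isGeneralizedJoin_zeroDivisorClass.classCard_pos

theorem secondSmallest_divisorLaplacian_le (hn : ¬ IsPrimePow n) {μ : ℝ}
    (hμ : IsSecondSmallestEigenvalue (divisorLaplacian n) μ) {p r : ProperDivisor n}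
    (hp : (p : ℕ).Prime) (hrp : r ≠ p) (hrp' : r ≠ p.codivisor) :
    μ ≤ ((p : ℕ).totient : ℝ) := by
  rw [divisorLaplacian_eq_weightedLaplacian] at hμ
  have hle := secondSmallest_le_of_neighborFinset_eq_singleton
    isGeneralizedJoin_zeroDivisorClass.classCard_pos hμ
    (p.divisorGraph_neighborFinset_of_prime hn hp) hrp hrp'
  rwa [classCard_zeroDivisorClass, p.div_codivisor] at hle

end ZeroDivisor

theorem theorem5p7 (n : ℕ) [NeZero n] (hn : n ≠ 1) :
    (¬ IsPrimePow n → ¬ (∃ p q : ℕ, p.Prime ∧ q.Prime ∧ p ≠ q ∧ n = p * q) →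
      ∃ μ : ℝ, IsAlgebraicConnectivity (zeroDivisorGraph (ZMod n)) μ ∧
        IsSecondSmallestEigenvalue (divisorLaplacian n) μ) ∧
    (¬ IsPrimePow n →
      ∃ ρ : ℝ, IsLaplacianSpectralRadius (zeroDivisorGraph (ZMod n)) ρ ∧
        IsLargestEigenvalue (divisorLaplacian n) ρ) := by
  have hjoin := isGeneralizedJoin_zeroDivisorClass (n := n)
  have hL := divisorLaplacian_eq_weightedLaplacian (n := n)
  have hsplits := splits_charpoly_divisorLaplacian (n := n)
  have hp := Nat.minFac_prime hn
  refine ⟨fun hpow hpq => ?_, fun hpow => ?_⟩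
  · set p := ProperDivisor.ofPrime hpow hp n.minFac_dvd
    obtain ⟨r, hrp, hrp'⟩ := p.exists_ne_ne_codivisor hpow hpq hp
    obtain ⟨μ, hμ⟩ := exists_isSecondSmallestEigenvalue
      (Fintype.one_lt_card_iff.mpr ⟨r, p, hrp⟩) hsplits
    have hle := secondSmallest_divisorLaplacian_le hpow hμ (p := p) hp hrp hrp'
    exact ⟨μ, hjoin.isAlgebraicConnectivity (hL ▸ hμ)
      fun d => hle.trans (totient_minFac_le_relWeight d), hμ⟩
  · have : Nonempty (ProperDivisor n) := ⟨.ofPrime hpow hp n.minFac_dvd⟩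
    obtain ⟨ρ, hρ⟩ := exists_isLargestEigenvalue hsplits
    exact ⟨ρ, hjoin.isLaplacianSpectralRadius (hL ▸ hρ)
      (ProperDivisor.exists_divisorGraph_adj hpow), hρ⟩
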